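/- Let $G=(V,E)$ be a finite simple connected graph and let $\tau$ be a subtree of $G$ (a nonempty connected acyclic subgraph) that is not spanning. Consider Wilson's algorithm on $G$ with initial condition $\tau$: set $V_X=V(\tau)$ and $E_X=E(\tau)$; while $V_X\neq V$, choose $v\in V\setminus V_X$ uniformly at random, run a simple random walk on $G$ from $v$ until it first visits a vertex of $V_X$, let $p_v$ be its loop erasure (loops are erased in chronological order, as they are created), and replace $V_X$ by $V_X\cup V(p_v)$ and $E_X$ by $E_X\cup E(p_v)$; when $V_X=V$, return $T=(V_X,E_X)$. Then the algorithm terminates with probability one, and its output $T$ is uniformly distributed on the set $\mathcal T_G(\tau)$ of the spanning trees of $G$ that contain $\tau$: each $t\in\mathcal T_G(\tau)$ is returned with probability $1/|\mathcal T_G(\tau)|$, and no other subgraph of $G$ is returned with positive probability. -/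

import Mathlib

open scoped ENNReal

namespace Wilson

universe u

variable {V : Type u}

/-- The configurations of Wilson's algorithm on the graph `G`. The current tree `(V_X, E_X)` is the
subgraph `H`.
* `loop H`: the algorithm is at the head of the while loop.
* `walking H w`: a random walk started at the vertex `v` is now at `x`, and `w` is its trajectory so
  far, listed backwards from the current position `x` to the starting vertex `v`.
* `returned H`: the algorithm has stopped and has returned `H`. -/
inductive State (G : SimpleGraph V) : Type u
  | loop (H : G.Subgraph) : State G
  | walking (H : G.Subgraph) {x v : V} (w : G.Walk x v) : State G
  | returned (H : G.Subgraph) : State G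

/-- The path obtained from a random walk by erasing its loops in chronological order, as they are
created. Here the trajectory `w` is listed backwards (current position first) and so is the
resulting path: when the walk makes one more step, to `y`, the new trajectory is `cons _ w`, and
`bypass` either prepends `y` to the loop erasure of `w`, or, if `y` already lies on that path, cuts
off everything that was visited on it after `y`. -/
noncomputable def loopErasure {G : SimpleGraph V} {x v : V} (w : G.Walk x v) : G.Walk x v :=
  letI := Classical.decEq V
  w.bypass

open Classical in
/-- One (random) step of Wilson's algorithm.
* At the head of the loop, if `V_X = V` then the current tree is returned; otherwise a vertex
  `v ∉ V_X` is chosen uniformly at random and a random walk is started at `v`.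
* While walking: if the walk is in `V_X` it stops, and its loop erasure is added to the
  current tree; otherwise it moves to a uniformly chosen neighbour of its current position.
  (A walk at a vertex without neighbours would stay there.) -/
noncomputable def step [Fintype V] (G : SimpleGraph V) : State G → PMF (State G)
  | .loop H =>
      if _h : Nonempty {v : V // v ∉ H.verts} then
        (PMF.uniformOfFintype {v : V // v ∉ H.verts}).map
          fun v => .walking H (SimpleGraph.Walk.nil : G.Walk v.1 v.1)
      else PMF.pure (.returned H)
  | .walking (x := x) H w =>
      if x ∈ H.verts then PMF.pure (.loop (H ⊔ (loopErasure w).toSubgraph))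
      else if _h : Nonempty (G.neighborSet x) then
        (PMF.uniformOfFintype (G.neighborSet x)).map
          fun y => .walking H (SimpleGraph.Walk.cons (SimpleGraph.Adj.symm y.2) w)
      else PMF.pure (.walking H w)
  | .returned H => PMF.pure (.returned H)

/-- The law of the configuration of Wilson's algorithm with initial condition `τ` after `n`
steps. -/
noncomputable def law [Fintype V] (G : SimpleGraph V) (τ : G.Subgraph) : ℕ → PMF (State G)
  | 0 => PMF.pure (.loop τ)
  | n + 1 => (law G τ n).bind (step G)

/-- The probability that Wilson's algorithm with initial condition `τ` stops after finitely many
steps and returns `T`. The events "`T` has been returned by time `n`" increase with `n`, so the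
probability of their union is the supremum. -/
noncomputable def returnProb [Fintype V] (G : SimpleGraph V) (τ T : G.Subgraph) : ℝ≥0∞ :=
  ⨆ n : ℕ, law G τ n (.returned T)

/-- A subgraph that is a tree (nonempty, connected and acyclic). -/
def IsSubtree {G : SimpleGraph V} (T : G.Subgraph) : Prop :=
  T.coe.IsTree

/-- The set of spanning trees of `G` that contain the subgraph `τ`. -/
def spanningTreesContaining (G : SimpleGraph V) (τ : G.Subgraph) : Set G.Subgraph :=
  {T | T.IsSpanning ∧ IsSubtree T ∧ τ ≤ T}

end Wilson

/-!
Let `Δ_B` be the Laplacian of `G` with Dirichlet boundary conditions on `B`. If the current tree `X`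
is contained in the spanning tree `T`, then `T` is returned with conditional probability
`1 / det Δ_{V(X)}`, which does not depend on `T`. Indeed, `T` is returned iff every later loop
erasure runs along `T`, that is, iff, listed from `X` outwards, each of its vertices is the parent
of the next one when `T` is rooted in the initial tree. When the walk is at `x` and its loop erasure
is `l`, the conditional probability of `T` is a sum over the suffixes `a :: l'` of `l`, according to
the most recent vertex `a` of `l` that survives to the end: the term is the Green function
`G_{B ∪ l'}(x, a)`, where `B = V(X)`, times `1 / det Δ_{B ∪ {a} ∪ l'}`. By Cramer's rule,
`G_B(a, a) = det Δ_{B ∪ {a}} / det Δ_B`, so that these terms telescope, and the function of the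
configuration obtained in this way is harmonic. As it is bounded and the expected running time is
finite, optional stopping shows that each `T` is returned with its initial value `1 / det Δ_{V(τ)}`.
-/

namespace Wilson

open Filter Matrix Topology

variable {α β V : Type*}

/-! ### Markov chains on a discrete state space -/

section MarkovChain

/-- The expectation of a nonnegative function. -/
noncomputable def expect (p : PMF α) (f : α → ℝ≥0∞) : ℝ≥0∞ := ∑' a, p a * f a

lemma expect_pure (a : α) (f : α → ℝ≥0∞) : expect (PMF.pure a) f = f a := by
  classical
  rw [expect, tsum_eq_single a fun b hb => by simp [PMF.pure_apply, hb]]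
  simp

lemma expect_bind (p : PMF α) (k : α → PMF β) (f : β → ℝ≥0∞) :
    expect (p.bind k) f = expect p fun a => expect (k a) f := by
  simp only [expect, PMF.bind_apply, ← ENNReal.tsum_mul_right, ← ENNReal.tsum_mul_left, mul_assoc]
  exact ENNReal.tsum_comm

lemma expect_map (p : PMF α) (g : α → β) (f : β → ℝ≥0∞) :
    expect (p.map g) f = expect p (f ∘ g) := by
  simp only [PMF.map, expect_bind, Function.comp_apply, expect_pure]
  rfl

lemma expect_add (p : PMF α) (f g : α → ℝ≥0∞) : expect p (f + g) = expect p f + expect p g := by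
  simp only [expect, Pi.add_apply, mul_add, ENNReal.tsum_add]

lemma expect_const_mul (p : PMF α) (c : ℝ≥0∞) (f : α → ℝ≥0∞) :
    (expect p fun a => c * f a) = c * expect p f := by
  simp only [expect, ← ENNReal.tsum_mul_left, mul_left_comm]

lemma expect_const (p : PMF α) (c : ℝ≥0∞) : (expect p fun _ => c) = c := by
  rw [expect, ENNReal.tsum_mul_right, p.tsum_coe, one_mul]

lemma expect_add_const (p : PMF α) (f : α → ℝ≥0∞) (c : ℝ≥0∞) :
    (expect p fun a => f a + c) = expect p f + c := by
  rw [← expect_const p c, ← expect_add, expect_const]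
  rfl

lemma expect_indicator_one (p : PMF α) (A : Set α) :
    expect p (A.indicator 1) = p.toOuterMeasure A := by
  simp only [expect, PMF.toOuterMeasure_apply, ← Set.indicator_mul_right, Pi.one_apply, mul_one]

lemma expect_mono {p : PMF α} {f g : α → ℝ≥0∞} (h : ∀ a ∈ p.support, f a ≤ g a) :
    expect p f ≤ expect p g := by
  refine ENNReal.tsum_le_tsum fun a => ?_
  by_cases ha : p a = 0
  · simp [ha]
  · gcongr
    exact h a ha

lemma expect_congr {p : PMF α} {f g : α → ℝ≥0∞} (h : ∀ a ∈ p.support, f a = g a) :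
    expect p f = expect p g :=
  le_antisymm (expect_mono fun a ha => (h a ha).le) (expect_mono fun a ha => (h a ha).ge)

lemma expect_uniformOfFintype [Fintype α] [Nonempty α] (f : α → ℝ≥0∞) :
    expect (PMF.uniformOfFintype α) f = (∑ a, f a) / Fintype.card α := by
  simp only [expect, tsum_fintype, PMF.uniformOfFintype_apply, ← Finset.mul_sum,
    ENNReal.div_eq_inv_mul]

variable {κ : α → PMF α} {μ : ℕ → PMF α} {I A : Set α} {f : α → ℝ≥0∞}

lemma support_subset_of_invariant (hμ : ∀ n, μ (n + 1) = (μ n).bind κ) (h₀ : (μ 0).support ⊆ I)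
    (hκ : ∀ s ∈ I, (κ s).support ⊆ I) (n : ℕ) : (μ n).support ⊆ I := by
  induction n with
  | zero => exact h₀
  | succ n ih =>
    rw [hμ, PMF.support_bind]
    exact Set.iUnion₂_subset fun s hs => hκ s (ih hs)

lemma expect_eq_of_harmonic (hμ : ∀ n, μ (n + 1) = (μ n).bind κ) (hI : ∀ n, (μ n).support ⊆ I)
    (hf : ∀ s ∈ I, expect (κ s) f = f s) (n : ℕ) : expect (μ n) f = expect (μ 0) f := by
  induction n with
  | zero => rfl
  | succ n ih =>
    rw [hμ, expect_bind, ← ih]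
    exact expect_congr fun s hs => hf s (hI n hs)

lemma monotone_apply_of_absorbing (hμ : ∀ n, μ (n + 1) = (μ n).bind κ) {a : α}
    (ha : κ a = PMF.pure a) : Monotone fun n => μ n a := by
  refine monotone_nat_of_le_succ fun n => ?_
  calc μ n a = μ n a * κ a a := by rw [ha, PMF.pure_apply_self, mul_one]
    _ ≤ ∑' s, μ n s * κ s a := ENNReal.le_tsum a
    _ = μ (n + 1) a := by rw [hμ, PMF.bind_apply]

/-- Foster's criterion: the expected time spent in `A` is at most the initial value of `f`. -/
lemma tendsto_toOuterMeasure_of_drift (hμ : ∀ n, μ (n + 1) = (μ n).bind κ)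
    (hI : ∀ n, (μ n).support ⊆ I) (h₀ : expect (μ 0) f ≠ ∞)
    (hf : ∀ s ∈ I, expect (κ s) f + A.indicator 1 s ≤ f s) :
    Tendsto (fun n => (μ n).toOuterMeasure A) atTop (𝓝 0) := by
  have hdrift (n : ℕ) : (μ n).toOuterMeasure A + expect (μ (n + 1)) f ≤ expect (μ n) f := by
    rw [hμ, expect_bind, ← expect_indicator_one, add_comm, ← expect_add]
    exact expect_mono fun s hs => hf s (hI n hs)
  have htime (n : ℕ) :
      ∑ i ∈ Finset.range n, (μ i).toOuterMeasure A + expect (μ n) f ≤ expect (μ 0) f := by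
    induction n with
    | zero => simp
    | succ n ih =>
      rw [Finset.sum_range_succ, add_assoc]
      exact (add_le_add_right (hdrift n) _).trans ih
  refine ENNReal.tendsto_atTop_zero_of_tsum_ne_top (ne_top_of_le_ne_top h₀ ?_)
  rw [ENNReal.tsum_eq_iSup_nat]
  exact iSup_le fun n => le_self_add.trans (htime n)

/-- Optional stopping: a bounded harmonic function is the probability of ending at `a`. -/
lemma iSup_apply_eq_expect_of_harmonic (hμ : ∀ n, μ (n + 1) = (μ n).bind κ)
    (hI : ∀ n, (μ n).support ⊆ I) (hf : ∀ s ∈ I, expect (κ s) f = f s)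
    (hA : Tendsto (fun n => (μ n).toOuterMeasure A) atTop (𝓝 0)) {a : α} (ha : f a = 1)
    {K : ℝ≥0∞} (hK : K ≠ ∞) (hfK : ∀ s, f s ≤ Set.indicator {a} 1 s + K * A.indicator 1 s) :
    ⨆ n, μ n a = expect (μ 0) f := by
  refine le_antisymm (iSup_le fun n => ?_) ?_
  · calc μ n a = μ n a * f a := by rw [ha, mul_one]
      _ ≤ expect (μ n) f := ENNReal.le_tsum a
      _ = expect (μ 0) f := expect_eq_of_harmonic hμ hI hf n
  · have hlim : Tendsto (fun n => (⨆ n, μ n a) + K * (μ n).toOuterMeasure A) atTop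
        (𝓝 (⨆ n, μ n a)) := by
      simpa using tendsto_const_nhds.add (ENNReal.Tendsto.const_mul hA (Or.inr hK))
    refine ge_of_tendsto' hlim fun n => ?_
    calc expect (μ 0) f = expect (μ n) f := (expect_eq_of_harmonic hμ hI hf n).symm
      _ ≤ expect (μ n) (Set.indicator {a} 1 + fun s => K * A.indicator 1 s) :=
        expect_mono fun s _ => hfK s
      _ = μ n a + K * (μ n).toOuterMeasure A := by
        rw [expect_add, expect_const_mul, expect_indicator_one, expect_indicator_one,
          PMF.toOuterMeasure_apply_singleton]
      _ ≤ (⨆ n, μ n a) + K * (μ n).toOuterMeasure A := by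
        gcongr
        exact le_iSup (fun n => μ n a) n

lemma tsum_iSup_apply_eq_one {e : β → α} (he : e.Injective)
    (hmono : ∀ b, Monotone fun n => μ n (e b))
    (htend : Tendsto (fun n => (μ n).toOuterMeasure (Set.range e)ᶜ) atTop (𝓝 0)) :
    ∑' b, ⨆ n, μ n (e b) = 1 := by
  refine le_antisymm ?_ ?_
  · rw [ENNReal.tsum_eq_iSup_sum]
    refine iSup_le fun s => ?_
    rw [ENNReal.finsetSum_iSup_of_monotone hmono]
    refine iSup_le fun n => ?_
    calc ∑ b ∈ s, μ n (e b) ≤ ∑' b, μ n (e b) := ENNReal.sum_le_tsum s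
      _ ≤ ∑' a, μ n a := ENNReal.tsum_comp_le_tsum_of_injective he _
      _ = 1 := (μ n).tsum_coe
  · refine ge_of_tendsto' (by simpa using tendsto_const_nhds.add htend) fun n => ?_
    calc 1 = (μ n).toOuterMeasure (Set.range e ∪ (Set.range e)ᶜ) := by
          rw [Set.union_compl_self, (PMF.toOuterMeasure_apply_eq_one_iff _ _).2 (Set.subset_univ _)]
      _ ≤ (μ n).toOuterMeasure (Set.range e) + (μ n).toOuterMeasure (Set.range e)ᶜ :=
        MeasureTheory.measure_union_le _ _
      _ ≤ (∑' b, ⨆ n, μ n (e b)) + (μ n).toOuterMeasure (Set.range e)ᶜ := by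
        gcongr
        rw [PMF.toOuterMeasure_apply, ← tsum_subtype, tsum_range _ he]
        exact ENNReal.tsum_le_tsum fun b => le_iSup (fun n => μ n (e b)) n

end MarkovChain

/-! ### The Dirichlet Laplacian and its Green function -/

lemma eq_of_adj_of_forall_le {G : SimpleGraph V} {a b : V} [Fintype (G.neighborSet a)]
    {f : V → ℝ} (hmin : ∀ y, f a ≤ f y)
    (ha : ∑ y ∈ G.neighborFinset a, f y ≤ G.degree a * f a) (hab : G.Adj a b) : f b = f a := by
  have hsum : ∑ _y ∈ G.neighborFinset a, f a = ∑ y ∈ G.neighborFinset a, f y := by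
    refine le_antisymm (Finset.sum_le_sum fun y _ => hmin y) ?_
    simpa using ha
  exact ((Finset.sum_eq_sum_iff_of_le fun y _ => hmin y).1 hsum b (by simpa using hab)).symm

section Green

variable [Fintype V] [DecidableEq V] (G : SimpleGraph V) [DecidableRel G.Adj] (B : Set V)

open Classical in
/-- The Laplacian of `G` with Dirichlet boundary conditions on `B`. The boundary is kept in the
index set, with the rows of the identity matrix, so that all these matrices have the same size. -/
noncomputable def dirichletLaplacian : Matrix V V ℝ :=
  .of fun x => if x ∈ B then Pi.single x 1 else G.lapMatrix ℝ x

/-- The Green function of the random walk on `G` killed on `B`: for `x, y ∉ B`, the expected number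
of visits to `y` of the walk started at `x`, divided by the degree of `y`. -/
noncomputable def green : Matrix V V ℝ := (dirichletLaplacian G B)⁻¹

/-- The expected time at which the random walk on `G` first visits `B`, as a function of its
starting point. -/
noncomputable def hittingTime : V → ℝ :=
  green G B *ᵥ Bᶜ.indicator fun x => (G.degree x : ℝ)

variable {G B}

lemma dirichletLaplacian_mulVec_of_mem {x : V} (hx : x ∈ B) (f : V → ℝ) :
    (dirichletLaplacian G B *ᵥ f) x = f x := by
  simp [dirichletLaplacian, Matrix.mulVec, hx]

lemma dirichletLaplacian_mulVec_of_notMem {x : V} (hx : x ∉ B) (f : V → ℝ) :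
    (dirichletLaplacian G B *ᵥ f) x = G.degree x * f x - ∑ y ∈ G.neighborFinset x, f y := by
  rw [← SimpleGraph.lapMatrix_mulVec_apply]
  simp [dirichletLaplacian, Matrix.mulVec, hx]

lemma dirichletLaplacian_univ : dirichletLaplacian G Set.univ = 1 := by
  ext x y
  simp [dirichletLaplacian, Matrix.one_apply, Pi.single_apply, eq_comm]

lemma dirichletLaplacian_insert (x : V) :
    dirichletLaplacian G (insert x B) = (dirichletLaplacian G B).updateRow x (Pi.single x 1) := by
  classical
  ext y z
  by_cases h : y = x
  · subst h; simp [dirichletLaplacian]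
  · simp [dirichletLaplacian, h, Matrix.updateRow_ne]

/-- The minimum principle: a walk from a negative minimum of `f` to `B` has an edge along which `f`
leaves its minimum, but `f` is superharmonic there. -/
lemma nonneg_of_dirichletLaplacian_mulVec_nonneg (hG : G.Connected) (hB : B.Nonempty) {f : V → ℝ}
    (hf : ∀ x, 0 ≤ (dirichletLaplacian G B *ᵥ f) x) (x : V) : 0 ≤ f x := by
  have := hG.nonempty
  obtain ⟨m, hm⟩ := Finite.exists_min f
  refine le_trans ?_ (hm x)
  by_contra! hneg
  have hfB {a : V} (ha : a ∈ B) : f a ≠ f m := fun h => by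
    have := hf a
    rw [dirichletLaplacian_mulVec_of_mem ha, h] at this
    exact this.not_gt hneg
  obtain ⟨b, hb⟩ := hB
  obtain ⟨d, -, hfst, hsnd⟩ :=
    (hG.preconnected m b).some.exists_boundary_dart {a | f a = f m} rfl (hfB hb)
  have hsuper := hf d.fst
  rw [dirichletLaplacian_mulVec_of_notMem fun h => hfB h hfst, sub_nonneg] at hsuper
  refine hsnd (Eq.trans (eq_of_adj_of_forall_le (fun y => ?_) hsuper d.adj) hfst)
  exact hfst.trans_le (hm y)

lemma isUnit_dirichletLaplacian (hG : G.Connected) (hB : B.Nonempty) :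
    IsUnit (dirichletLaplacian G B) := by
  rw [← Matrix.mulVec_injective_iff_isUnit]
  intro f g hfg
  replace hfg : dirichletLaplacian G B *ᵥ f = dirichletLaplacian G B *ᵥ g := hfg
  refine le_antisymm (fun x => sub_nonneg.1 ?_) (fun x => sub_nonneg.1 ?_)
  · exact nonneg_of_dirichletLaplacian_mulVec_nonneg hG hB (f := g - f)
      (by simp [Matrix.mulVec_sub, hfg]) x
  · exact nonneg_of_dirichletLaplacian_mulVec_nonneg hG hB (f := f - g)
      (by simp [Matrix.mulVec_sub, hfg]) x

lemma dirichletLaplacian_mul_green (hG : G.Connected) (hB : B.Nonempty) :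
    dirichletLaplacian G B * green G B = 1 :=
  Matrix.mul_nonsing_inv _ ((Matrix.isUnit_iff_isUnit_det _).1 (isUnit_dirichletLaplacian hG hB))

lemma dirichletLaplacian_mulVec_green (hG : G.Connected) (hB : B.Nonempty) (a : V) :
    dirichletLaplacian G B *ᵥ (green G B).col a = Pi.single a 1 := by
  rw [← Matrix.mulVec_single_one, Matrix.mulVec_mulVec, dirichletLaplacian_mul_green hG hB,
    Matrix.one_mulVec]

lemma green_nonneg (hG : G.Connected) (hB : B.Nonempty) (x a : V) : 0 ≤ green G B x a := by
  refine nonneg_of_dirichletLaplacian_mulVec_nonneg hG hB (f := (green G B).col a) (fun y => ?_) x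
  rw [dirichletLaplacian_mulVec_green hG hB]
  exact (Pi.single_nonneg (α := fun _ => ℝ)).2 zero_le_one y

lemma green_of_mem (hG : G.Connected) {x : V} (hx : x ∈ B) (a : V) :
    green G B x a = if x = a then 1 else 0 := by
  have := congrFun (dirichletLaplacian_mulVec_green hG ⟨x, hx⟩ a) x
  rwa [dirichletLaplacian_mulVec_of_mem hx, Pi.single_apply] at this

lemma degree_mul_green_sub_sum (hG : G.Connected) (hB : B.Nonempty) {x : V} (hx : x ∉ B) (a : V) :
    G.degree x * green G B x a - ∑ y ∈ G.neighborFinset x, green G B y a =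
      if x = a then 1 else 0 := by
  have := congrFun (dirichletLaplacian_mulVec_green hG hB a) x
  rwa [dirichletLaplacian_mulVec_of_notMem hx, Pi.single_apply] at this

/-- Cramer's rule. -/
lemma green_self_mul_det (hG : G.Connected) (hB : B.Nonempty) (x : V) :
    green G B x x * (dirichletLaplacian G B).det = (dirichletLaplacian G (insert x B)).det := by
  have := ((Matrix.isUnit_iff_isUnit_det _).1 (isUnit_dirichletLaplacian hG hB)).ne_zero
  rw [green, Matrix.inv_def, Matrix.smul_apply, Matrix.adjugate_apply, dirichletLaplacian_insert,
    Ring.inverse_eq_inv', smul_eq_mul]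
  field_simp

lemma det_dirichletLaplacian_pos (hG : G.Connected) (hB : B.Nonempty) :
    0 < (dirichletLaplacian G B).det := by
  induction B using WellFoundedGT.induction with
  | ind B ih =>
    rcases eq_or_ne B Set.univ with rfl | hne
    · simp [dirichletLaplacian_univ]
    obtain ⟨x, hx⟩ := (Set.ne_univ_iff_exists_notMem B).1 hne
    refine pos_of_mul_pos_right ?_ (green_nonneg hG hB x x)
    rw [green_self_mul_det hG hB]
    exact ih _ (Set.ssubset_insert hx) (Set.insert_nonempty x B)

lemma green_self_div_det (hG : G.Connected) (hB : B.Nonempty) (x : V) :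
    green G B x x / (dirichletLaplacian G (insert x B)).det = (dirichletLaplacian G B).det⁻¹ := by
  have hdet := (det_dirichletLaplacian_pos hG hB).ne'
  have hdet_insert := (det_dirichletLaplacian_pos hG (Set.insert_nonempty x B)).ne'
  rw [div_eq_iff hdet_insert, ← green_self_mul_det hG hB]
  field_simp

lemma dirichletLaplacian_mulVec_hittingTime (hG : G.Connected) (hB : B.Nonempty) :
    dirichletLaplacian G B *ᵥ hittingTime G B = Bᶜ.indicator fun x => (G.degree x : ℝ) := by
  rw [hittingTime, Matrix.mulVec_mulVec, dirichletLaplacian_mul_green hG hB, Matrix.one_mulVec]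

lemma hittingTime_nonneg (hG : G.Connected) (hB : B.Nonempty) (x : V) :
    0 ≤ hittingTime G B x := by
  refine nonneg_of_dirichletLaplacian_mulVec_nonneg hG hB (fun y => ?_) x
  rw [dirichletLaplacian_mulVec_hittingTime hG hB]
  exact Set.indicator_nonneg (fun y _ => Nat.cast_nonneg _) y

lemma degree_mul_hittingTime (hG : G.Connected) (hB : B.Nonempty) {x : V} (hx : x ∉ B) :
    G.degree x * hittingTime G B x =
      G.degree x + ∑ y ∈ G.neighborFinset x, hittingTime G B y := by
  have := congrFun (dirichletLaplacian_mulVec_hittingTime hG hB) x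
  rwa [dirichletLaplacian_mulVec_of_notMem hx, Set.indicator_of_mem (Set.mem_compl hx),
    sub_eq_iff_eq_add] at this

end Green

/-! ### Paths in trees -/

section IsParent

open SimpleGraph

/-- `IsParent T r a b` says that `a` is the parent of `b` in the tree `T` rooted at `r`. -/
def IsParent (T : SimpleGraph V) (r a b : V) : Prop :=
  T.Adj a b ∧ T.dist r b = T.dist r a + 1

variable {T : SimpleGraph V} {r : V}

lemma nodup_of_isChain_isParent {l : List V} (hl : l.IsChain (IsParent T r)) : l.Nodup := by
  have hmono : (l.map (T.dist r)).IsChain (· < ·) :=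
    (List.isChain_map _).2 (hl.imp fun a b hab => by grind [IsParent])
  exact .of_map _ ((List.isChain_iff_pairwise.1 hmono).imp fun h => h.ne)

lemma length_eq_dist_of_isPath (hT : T.IsTree) {x : V} {p : T.Walk x r} (hp : p.IsPath) :
    p.length = T.dist r x := by
  obtain ⟨q, hq, hlength⟩ := hT.connected.exists_path_of_dist x r
  rw [(hT.existsUnique_path x r).unique hp hq, hlength, dist_comm]

lemma existsUnique_isParent (hT : T.IsTree) {x : V} (hx : x ≠ r) : ∃! a, IsParent T r a x := by
  obtain ⟨p, hp, huniq⟩ := hT.existsUnique_path x r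
  have hnil : ¬ p.Nil := Walk.not_nil_of_ne hx
  refine ⟨p.snd, ⟨(p.adj_snd hnil).symm, ?_⟩, fun a ⟨hadj, hdist⟩ => ?_⟩
  · rw [← length_eq_dist_of_isPath hT hp, ← length_eq_dist_of_isPath hT hp.tail,
      p.length_tail_add_one hnil]
  · obtain ⟨q, hlength⟩ := hT.connected.exists_walk_length_eq_dist a r
    have hpath : (Walk.cons hadj.symm q).IsPath := Walk.isPath_of_length_eq_dist _ <| by
      rw [Walk.length_cons, hlength, dist_comm (u := x), hdist, dist_comm]
    rw [← huniq _ hpath, Walk.snd_cons]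

lemma adj_iff_isParent (hT : T.IsTree) {x y : V} {q : T.Walk x r} (hq : q.IsPath)
    (hy : y ∉ q.support) : T.Adj x y ↔ IsParent T r x y := by
  refine ⟨fun h => ⟨h, ?_⟩, And.left⟩
  rw [← length_eq_dist_of_isPath hT hq, ← length_eq_dist_of_isPath hT (hq.cons hy (h := h.symm)),
    Walk.length_cons]

end IsParent

section Subtrees

open SimpleGraph

variable {G : SimpleGraph V} {H T : G.Subgraph} {x v r : V}

lemma nonempty_verts_of_isSubtree (hH : IsSubtree H) : H.verts.Nonempty :=
  Set.nonempty_coe_sort.1 hH.connected.nonempty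

lemma isTree_spanningCoe (hTs : T.IsSpanning) (hT : IsSubtree T) : T.spanningCoe.IsTree :=
  (T.spanningCoeEquivCoeOfSpanning hTs).isTree_iff.2 hT

lemma eq_of_le_of_isSubtree (hH : IsSubtree H) (hT : IsSubtree T) (hHs : H.IsSpanning)
    (hTs : T.IsSpanning) (hle : H ≤ T) : H = T := by
  refine hle.antisymm ⟨fun a _ => hHs a, fun a b hab => ?_⟩
  exact (isTree_iff_minimal_connected.1 (isTree_spanningCoe hTs hT)).2
    (isTree_spanningCoe hHs hH).connected (Subgraph.spanningCoe_le_of_le hle) hab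

lemma exists_isPath_spanningCoe (hH : H.Connected) (hle : H ≤ T) (hx : x ∈ H.verts)
    (hr : r ∈ H.verts) :
    ∃ q : T.spanningCoe.Walk x r, q.IsPath ∧ ∀ y ∈ q.support, y ∈ H.verts := by
  obtain ⟨q, hq⟩ := (hH.preconnected.coe ⟨x, hx⟩ ⟨r, hr⟩).exists_isPath
  refine ⟨q.map ⟨Subtype.val, fun h => hle.2 h⟩, hq.map Subtype.val_injective, fun y hy => ?_⟩
  obtain ⟨z, -, rfl⟩ := List.mem_map.1 (Walk.support_map _ _ ▸ hy)
  exact z.2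

/-- Appending to the path `q` from the root the edges of `p` one at a time, each new vertex has
its predecessor as its parent. -/
lemma toSubgraph_le_iff_isChain_isParent (hT : T.spanningCoe.IsTree) (hTs : T.IsSpanning)
    {q : T.spanningCoe.Walk x r} (hq : q.IsPath) {p : G.Walk x v} (hp : p.IsPath)
    (hpq : ∀ y ∈ p.support.tail, y ∉ q.support) :
    p.toSubgraph ≤ T ↔ p.support.IsChain (IsParent T.spanningCoe r) := by
  induction p with
  | nil => simpa using hTs _
  | @cons x y v h p ih =>
    rw [Walk.cons_isPath_iff] at hp
    rw [Walk.support_cons, List.tail_cons] at hpq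
    have hy : y ∉ q.support := hpq y p.start_mem_support
    rw [Walk.toSubgraph, sup_le_iff, subgraphOfAdj_le_iff, Walk.support_cons,
      ← Walk.cons_tail_support p, List.isChain_cons_cons, Walk.cons_tail_support,
      ← adj_iff_isParent hT hq hy, Subgraph.spanningCoe_adj]
    refine and_congr_right fun hxy => ?_
    have hyx : T.spanningCoe.Adj y x := hxy.symm
    refine ih (hq.cons hy (h := hyx)) hp.1 fun z hz => ?_
    rw [Walk.support_cons, List.mem_cons, not_or]
    have hz' := List.mem_of_mem_tail hz
    refine ⟨?_, hpq z hz'⟩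
    rintro rfl
    exact (Walk.cons_tail_support p ▸ hp.1.support_nodup).notMem hz

lemma verts_sup_toSubgraph (hx : x ∈ H.verts) (p : G.Walk x v) :
    (H ⊔ p.toSubgraph).verts = H.verts ∪ {y | y ∈ p.support.tail} := by
  ext y
  rw [Subgraph.verts_sup, Set.mem_union, Set.mem_union, Walk.mem_verts_toSubgraph,
    Walk.mem_support_iff, Set.mem_ofPred_eq]
  grind

lemma isSubtree_iff [Finite V] :
    IsSubtree H ↔ H.Connected ∧ H.edgeSet.ncard + 1 = H.verts.ncard := by
  rw [IsSubtree, isTree_iff_connected_and_card, Subgraph.connected_iff', Nat.card_coe_set_eq,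
    Nat.card_coe_set_eq, ← Subgraph.image_coe_edgeSet_coe,
    Set.ncard_image_of_injective _ (Sym2.map.injective Subtype.val_injective)]

lemma ncard_verts_le_ncard_edgeSet_add_one (hH : H.Connected) :
    H.verts.ncard ≤ H.edgeSet.ncard + 1 := by
  have h := (Subgraph.connected_iff'.1 hH).card_vert_le_card_edgeSet_add_one
  rwa [Nat.card_coe_set_eq, Nat.card_coe_set_eq,
    ← Set.ncard_image_of_injective _ (Sym2.map.injective Subtype.val_injective),
    Subgraph.image_coe_edgeSet_coe] at h

lemma ncard_edgeSet_toSubgraph_le (p : G.Walk x v) : p.toSubgraph.edgeSet.ncard ≤ p.length := by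
  classical
  have hedges : p.toSubgraph.edgeSet = (p.edges.toFinset : Set (Sym2 V)) := by
    ext e; simp
  rw [hedges, Set.ncard_coe_finset, ← p.length_edges]
  exact List.toFinset_card_le _

lemma ncard_verts_sup_toSubgraph [Finite V] (hx : x ∈ H.verts) {p : G.Walk x v} (hp : p.IsPath)
    (hd : ∀ y ∈ p.support.tail, y ∉ H.verts) :
    (H ⊔ p.toSubgraph).verts.ncard = H.verts.ncard + p.length := by
  classical
  have hdisj : Disjoint H.verts {y | y ∈ p.support.tail} := Set.disjoint_right.2 hd
  rw [verts_sup_toSubgraph hx, Set.ncard_union_eq hdisj,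
    ← List.coe_toFinset, Set.ncard_coe_finset,
    List.toFinset_card_of_nodup hp.support_nodup.tail, List.length_tail, Walk.length_support,
    Nat.add_sub_cancel]

lemma isSubtree_sup_toSubgraph [Finite V] (hH : IsSubtree H) (hx : x ∈ H.verts)
    {p : G.Walk x v} (hp : p.IsPath) (hd : ∀ y ∈ p.support.tail, y ∉ H.verts) :
    IsSubtree (H ⊔ p.toSubgraph) := by
  obtain ⟨hHcon, hcard⟩ := isSubtree_iff.1 hH
  have hcon : (H ⊔ p.toSubgraph).Connected :=
    Subgraph.connected_sup hHcon.preconnected p.toSubgraph_connected.preconnected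
      ⟨x, hx, p.start_mem_verts_toSubgraph⟩
  refine isSubtree_iff.2 ⟨hcon, le_antisymm ?_ (ncard_verts_le_ncard_edgeSet_add_one hcon)⟩
  calc (H ⊔ p.toSubgraph).edgeSet.ncard + 1
      ≤ H.edgeSet.ncard + p.toSubgraph.edgeSet.ncard + 1 := by
        rw [Subgraph.edgeSet_sup]
        gcongr
        exact Set.ncard_union_le _ _
    _ ≤ H.edgeSet.ncard + p.length + 1 := by
        gcongr
        exact ncard_edgeSet_toSubgraph_le p
    _ = (H ⊔ p.toSubgraph).verts.ncard := by
        rw [ncard_verts_sup_toSubgraph hx hp hd, ← hcard]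
        ring

end Subtrees

section LoopErasure

variable {G : SimpleGraph V} {x y v : V}

lemma loopErasure_eq_bypass [DecidableEq V] (w : G.Walk x v) : loopErasure w = w.bypass := by
  rw [loopErasure, Subsingleton.elim (Classical.decEq V) ‹DecidableEq V›]

lemma loopErasure_isPath (w : G.Walk x v) : (loopErasure w).IsPath := by
  classical
  exact loopErasure_eq_bypass w ▸ w.bypass_isPath

lemma notMem_of_mem_tail_support_loopErasure {B : Set V} {w : G.Walk x v}
    (hw : ∀ y ∈ w.support.tail, y ∉ B) : ∀ y ∈ (loopErasure w).support.tail, y ∉ B := by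
  classical
  intro y hy
  have hyw : y ∈ w.support := w.support_bypass_subset_support <|
    loopErasure_eq_bypass w ▸ List.mem_of_mem_tail hy
  rcases w.mem_support_iff.1 hyw with rfl | hyw
  · have hnodup := (loopErasure_isPath w).support_nodup
    rw [← SimpleGraph.Walk.cons_tail_support] at hnodup
    exact absurd hy hnodup.notMem
  · exact hw y hyw

variable [DecidableEq V]

/-- One step of the chronological loop erasure, on lists of vertices with the most recent one
first: the new vertex `y` is put in front, unless it is already in the list, in which case
everything in front of it is deleted. -/
def loopErasedCons (y : V) (l : List V) : List V :=
  if y ∈ l then l.drop (l.idxOf y) else y :: l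

lemma support_loopErasure_cons (h : G.Adj y x) (w : G.Walk x v) :
    (loopErasure (.cons h w)).support = loopErasedCons y (loopErasure w).support := by
  simp only [loopErasure_eq_bypass, SimpleGraph.Walk.bypass, loopErasedCons]
  split_ifs with hy
  · have hidx : w.bypass.support.idxOf y ≤ w.bypass.length := by
      simpa [Nat.lt_succ_iff] using List.idxOf_lt_length_iff.2 hy
    rw [SimpleGraph.Walk.dropUntil_eq_drop, SimpleGraph.Walk.support_copy,
      SimpleGraph.Walk.drop_support_eq_support_drop_min, min_eq_left hidx]
  · rfl

end LoopErasure

/-! ### The potential of a loop-erased walk -/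

section Potential

variable [Fintype V] [DecidableEq V] (G : SimpleGraph V) [DecidableRel G.Adj]
  (R : V → V → Prop) [DecidableRel R] (B : Set V)

/-- Let `R` be the parent relation of a spanning tree with root in `B`, and let a random walk at
`x`, with current loop erasure `l` (listed backwards), be stopped on `B`. Then `potential G R B l x`
is the probability that the final loop erasure is a chain for `R`, divided by the Dirichlet
determinant of the domain that is left. The summand of a suffix `a :: l'` of `l` accounts for the
walks that return to `a` before they hit `B` or `l'`, and at last leave it for good towards its
parent. -/
noncomputable def potential : List V → V → ℝ
  | [], _ => 0
  | a :: l, x => potential l x +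
      if (a :: l).IsChain R then
        green G (B ∪ {y | y ∈ l}) x a / (dirichletLaplacian G (insert a (B ∪ {y | y ∈ l}))).det
      else 0

variable {G R B} {l : List V} {x y : V}

lemma potential_nonneg (hG : G.Connected) (hB : B.Nonempty) (l : List V) (x : V) :
    0 ≤ potential G R B l x := by
  induction l with
  | nil => exact le_rfl
  | cons a l ih =>
    rw [potential]
    refine add_nonneg ih ?_
    split_ifs
    · exact div_nonneg (green_nonneg hG (hB.mono Set.subset_union_left) _ _)
        (det_dirichletLaplacian_pos hG (Set.insert_nonempty _ _)).le
    · exact le_rfl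

lemma potential_cons_of_mem (hG : G.Connected) {a : V} (hx : x ∈ B ∪ {y | y ∈ l}) (hxa : x ≠ a) :
    potential G R B (a :: l) x = potential G R B l x := by
  rw [potential, green_of_mem hG hx, if_neg hxa, zero_div, ite_self, add_zero]

lemma potential_cons_self (hG : G.Connected) (hB : B.Nonempty) (l : List V) (y : V) :
    potential G R B (y :: l) y = potential G R B l y +
      if (y :: l).IsChain R then (dirichletLaplacian G (B ∪ {z | z ∈ l})).det⁻¹ else 0 := by
  rw [potential, green_self_div_det hG (hB.mono Set.subset_union_left)]

lemma potential_eq_zero_of_mem (hG : G.Connected) (hl : ∀ y ∈ l, y ∉ B) (hx : x ∈ B) :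
    potential G R B l x = 0 := by
  induction l with
  | nil => rfl
  | cons a l ih =>
    rw [List.forall_mem_cons] at hl
    rw [potential_cons_of_mem hG (Or.inl hx) (ne_of_mem_of_not_mem hx hl.1), ih hl.2]

lemma potential_cons_self_of_mem (hG : G.Connected) (hl : ∀ y ∈ l, y ∉ B) (hx : x ∈ B) :
    potential G R B (x :: l) x =
      if (x :: l).IsChain R then (dirichletLaplacian G (B ∪ {z | z ∈ l})).det⁻¹ else 0 := by
  rw [potential_cons_self hG ⟨x, hx⟩, potential_eq_zero_of_mem hG hl hx, zero_add]

lemma potential_drop_idxOf (hG : G.Connected) (hy : y ∈ l) :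
    potential G R B (l.drop (l.idxOf y)) y = potential G R B l y := by
  induction l with
  | nil => rfl
  | cons a l ih =>
    rcases eq_or_ne y a with rfl | hya
    · rw [List.idxOf_cons_self, List.drop_zero]
    · have hyl : y ∈ l := List.mem_of_ne_of_mem hya hy
      rw [List.idxOf_cons_ne _ hya.symm, List.drop_succ_cons, ih hyl,
        potential_cons_of_mem hG (Or.inr hyl) hya]

lemma potential_loopErasedCons (hG : G.Connected) (hB : B.Nonempty) (l : List V) (y : V) :
    potential G R B (loopErasedCons y l) y = potential G R B l y +
      if y ∉ l ∧ (y :: l).IsChain R then (dirichletLaplacian G (B ∪ {z | z ∈ l})).det⁻¹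
      else 0 := by
  by_cases hy : y ∈ l
  · rw [loopErasedCons, if_pos hy, potential_drop_idxOf hG hy,
      if_neg (not_and_of_not_left _ (not_not.2 hy)), add_zero]
  · rw [loopErasedCons, if_neg hy, potential_cons_self hG hB]
    simp only [hy, not_false_eq_true, true_and]

lemma degree_mul_potential_of_notMem (hG : G.Connected) (hB : B.Nonempty) (hx : x ∉ B)
    (hxl : x ∉ l) :
    G.degree x * potential G R B l x = ∑ y ∈ G.neighborFinset x, potential G R B l y := by
  induction l with
  | nil => simp [potential]
  | cons a l ih =>
    rw [List.mem_cons, not_or] at hxl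
    have hgreen := degree_mul_green_sub_sum (B := B ∪ {y | y ∈ l}) hG
      (hB.mono Set.subset_union_left) (x := x) (by simp [hx, hxl.2]) a
    rw [if_neg hxl.1, sub_eq_zero] at hgreen
    simp only [potential, mul_add, Finset.sum_add_distrib, ih hxl.2]
    congr 1
    split_ifs
    · rw [← Finset.sum_div, ← hgreen, mul_div_assoc]
    · simp

lemma degree_mul_potential_cons (hG : G.Connected) (hB : B.Nonempty) (hx : x ∉ B)
    (hxl : x ∉ l) :
    G.degree x * potential G R B (x :: l) x =
      ∑ y ∈ G.neighborFinset x, potential G R B (x :: l) y +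
        if (x :: l).IsChain R then (dirichletLaplacian G (B ∪ {y | y ∈ x :: l})).det⁻¹
        else 0 := by
  have hset : B ∪ {y | y ∈ x :: l} = insert x (B ∪ {y | y ∈ l}) := by
    ext y; simp [or_left_comm]
  have hgreen := degree_mul_green_sub_sum (B := B ∪ {y | y ∈ l}) hG
    (hB.mono Set.subset_union_left) (x := x) (by simp [hx, hxl]) x
  rw [if_pos rfl, sub_eq_iff_eq_add] at hgreen
  simp only [potential, mul_add, Finset.sum_add_distrib, hset,
    degree_mul_potential_of_notMem hG hB hx hxl, add_assoc]
  congr 1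
  split_ifs
  · rw [← Finset.sum_div, mul_div_assoc', hgreen]
    ring
  · simp

/-- The potential is harmonic: what the loops through `x` lose in one step is the weight of the
unique neighbour `p` of `x` by which a chain `x :: l` can be extended. -/
lemma degree_mul_potential_eq_sum (hG : G.Connected) (hB : B.Nonempty)
    (hR : ∀ l : List V, l.IsChain R → l.Nodup) {p : V} (hp : G.Adj x p)
    (hRp : ∀ y, R y x ↔ y = p) (hx : x ∉ B) (hxl : x ∉ l) :
    G.degree x * potential G R B (x :: l) x =
      ∑ y ∈ G.neighborFinset x, potential G R B (loopErasedCons y (x :: l)) y := by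
  have hext (y : V) : (y ∉ x :: l ∧ (y :: x :: l).IsChain R) ↔ y = p ∧ (x :: l).IsChain R := by
    rw [← hRp y, ← List.isChain_cons_cons, and_iff_right_iff_imp]
    exact fun h => (hR _ h).notMem
  simp only [potential_loopErasedCons hG hB, hext, Finset.sum_add_distrib, ite_and]
  rw [Finset.sum_ite_eq' _ p, if_pos ((G.mem_neighborFinset x p).2 hp),
    degree_mul_potential_cons hG hB hx hxl]

end Potential


/-! ### The steps of Wilson's algorithm -/

section Steps

variable {G : SimpleGraph V} {τ H : G.Subgraph} {x v : V}

lemma nonempty_neighborSet (hG : G.Connected) {B : Set V} (hB : B.Nonempty) (hx : x ∉ B) :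
    Nonempty (G.neighborSet x) := by
  obtain ⟨r, hr⟩ := hB
  have : Nontrivial V := ⟨x, r, (ne_of_mem_of_not_mem hr hx).symm⟩
  exact (hG.preconnected.exists_adj_of_nontrivial x).elim fun y hy => ⟨⟨y, hy⟩⟩

lemma expect_uniformOfFintype_neighborSet [Fintype (G.neighborSet x)] [Nonempty (G.neighborSet x)]
    {F : V → ℝ} (hF : ∀ y, 0 ≤ F y) {c : ℝ}
    (hc : G.degree x * c = ∑ y ∈ G.neighborFinset x, F y) :
    (expect (PMF.uniformOfFintype (G.neighborSet x)) fun y => ENNReal.ofReal (F y)) =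
      ENNReal.ofReal c := by
  have hdeg : (0 : ℝ) < G.degree x := by
    rw [← SimpleGraph.card_neighborSet_eq_degree]
    exact_mod_cast Fintype.card_pos
  have hsum : ∑ y : G.neighborSet x, F y = G.degree x * c := by
    rw [hc]
    exact (Finset.sum_subtype _ (fun y => G.mem_neighborFinset x y) F).symm
  rw [expect_uniformOfFintype,
    ← ENNReal.ofReal_sum_of_nonneg fun (y : G.neighborSet x) _ => hF y, hsum,
    SimpleGraph.card_neighborSet_eq_degree, ← ENNReal.ofReal_natCast,
    ← ENNReal.ofReal_div_of_pos hdeg, mul_div_cancel_left₀ _ hdeg.ne']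

/-- The property of a configuration that the algorithm with initial condition `τ` maintains: the
current tree is a tree that contains `τ`, the current walk started outside of it and has not hit
it before its current position, and a returned tree is spanning. -/
def Invariant (τ : G.Subgraph) : State G → Prop
  | .loop H => τ ≤ H ∧ IsSubtree H
  | .walking (v := v) H w =>
      (τ ≤ H ∧ IsSubtree H) ∧ v ∉ H.verts ∧ ∀ y ∈ w.support.tail, y ∉ H.verts
  | .returned H => (τ ≤ H ∧ IsSubtree H) ∧ H.IsSpanning

/-- The configurations in which the algorithm has not stopped yet. -/
def running (G : SimpleGraph V) : Set (State G) := (Set.range State.returned)ᶜ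

variable [Fintype V]

lemma step_loop_of_isSpanning (hH : H.IsSpanning) :
    step G (.loop H) = PMF.pure (.returned H) := by
  rw [step, dif_neg]
  exact fun ⟨v, hv⟩ => hv (hH v)

open Classical in
lemma step_loop_of_nonempty [hne : Nonempty {v : V // v ∉ H.verts}] :
    step G (.loop H) = (PMF.uniformOfFintype {v : V // v ∉ H.verts}).map
      fun v => .walking H (.nil : G.Walk v.1 v.1) := by
  rw [step, dif_pos hne]

lemma step_walking_of_mem (w : G.Walk x v) (hx : x ∈ H.verts) :
    step G (.walking H w) = PMF.pure (.loop (H ⊔ (loopErasure w).toSubgraph)) := by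
  rw [step, if_pos hx]

open Classical in
lemma step_walking_of_notMem [hne : Nonempty (G.neighborSet x)] (w : G.Walk x v)
    (hx : x ∉ H.verts) :
    step G (.walking H w) = (PMF.uniformOfFintype (G.neighborSet x)).map
      fun y => .walking H (.cons y.2.symm w) := by
  rw [step, if_neg hx, dif_pos hne]

lemma support_step_loop_subset (hH : Invariant τ (.loop H)) :
    (step G (.loop H)).support ⊆ {s | Invariant τ s} := by
  by_cases hs : H.IsSpanning
  · rw [step_loop_of_isSpanning hs, PMF.support_pure, Set.singleton_subset_iff]
    exact ⟨hH, hs⟩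
  · have : Nonempty {v : V // v ∉ H.verts} := nonempty_subtype.2 (not_forall.1 hs)
    rw [step_loop_of_nonempty, PMF.support_map]
    exact Set.image_subset_iff.2 fun v _ => ⟨hH, v.2, by simp⟩

lemma support_step_walking_subset (hG : G.Connected) {w : G.Walk x v}
    (hw : Invariant τ (.walking H w)) :
    (step G (.walking H w)).support ⊆ {s | Invariant τ s} := by
  obtain ⟨⟨hle, hH⟩, hv, htail⟩ := hw
  by_cases hx : x ∈ H.verts
  · rw [step_walking_of_mem w hx, PMF.support_pure, Set.singleton_subset_iff]
    exact ⟨hle.trans le_sup_left, isSubtree_sup_toSubgraph hH hx (loopErasure_isPath w)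
      (notMem_of_mem_tail_support_loopErasure htail)⟩
  · have := nonempty_neighborSet hG (nonempty_verts_of_isSubtree hH) hx
    rw [step_walking_of_notMem w hx, PMF.support_map]
    refine Set.image_subset_iff.2 fun y _ => ⟨⟨hle, hH⟩, hv, fun z hz => ?_⟩
    rcases w.mem_support_iff.1 hz with rfl | hz
    exacts [hx, htail z hz]

lemma support_step_subset (hG : G.Connected) {s : State G} (hs : Invariant τ s) :
    (step G s).support ⊆ {s | Invariant τ s} := by
  cases s with
  | loop H => exact support_step_loop_subset hs
  | walking H w => exact support_step_walking_subset hG hs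
  | returned H => rwa [step, PMF.support_pure, Set.singleton_subset_iff]

lemma support_law_subset (hG : G.Connected) (hτ : IsSubtree τ) (n : ℕ) :
    (law G τ n).support ⊆ {s | Invariant τ s} := by
  refine support_subset_of_invariant (fun _ => rfl) ?_ (fun _ hs => support_step_subset hG hs) n
  rw [law, PMF.support_pure, Set.singleton_subset_iff]
  exact ⟨le_rfl, hτ⟩

end Steps

/-! ### Uniformity -/

section Uniformity

variable [Fintype V] {G : SimpleGraph V} {T H : G.Subgraph} {r x v : V}

open Classical in
/-- The conditional probability, given the configuration, that the algorithm returns the tree `T`.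
The root `r` of `T` must lie in the initial tree; it only serves to orient the edges of `T`. -/
noncomputable def condReturnProb (T : G.Subgraph) (r : V) : State G → ℝ≥0∞
  | .loop H => if H ≤ T then ENNReal.ofReal (dirichletLaplacian G H.verts).det⁻¹ else 0
  | .walking (x := x) H w =>
      if H ≤ T then
        ENNReal.ofReal
          (potential G (IsParent T.spanningCoe r) H.verts (loopErasure w).support x)
      else 0
  | .returned H => if H = T then 1 else 0

lemma condReturnProb_returned_self : condReturnProb T r (.returned T) = 1 := if_pos rfl

lemma exists_condReturnProb_le (T : G.Subgraph) (r : V) :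
    ∃ K : ℝ≥0∞, K ≠ ∞ ∧ ∀ s,
      condReturnProb T r s ≤ Set.indicator {.returned T} 1 s + K * (running G).indicator 1 s := by
  classical
  let f (q : G.Subgraph × {l : List V // l.Nodup} × V) : ℝ≥0∞ :=
    ENNReal.ofReal (dirichletLaplacian G q.1.verts).det⁻¹ +
      ENNReal.ofReal (potential G (IsParent T.spanningCoe r) q.1.verts q.2.1 q.2.2)
  refine ⟨⨆ q, f q, iSup_ne_top fun q => by simp [f], fun s => ?_⟩
  cases s with
  | loop H =>
    have hf : f (H, ⟨[], List.nodup_nil⟩, r) ≤ ⨆ q, f q := le_iSup f _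
    have hbound : condReturnProb T r (.loop H) ≤ ⨆ q, f q :=
      (ite_le_sup _ _ _).trans (sup_le (le_self_add.trans hf) zero_le)
    simpa [running] using hbound
  | @walking H x v w =>
    have hf : f (H, ⟨_, (loopErasure_isPath w).support_nodup⟩, x) ≤ ⨆ q, f q := le_iSup f _
    have hbound : condReturnProb T r (.walking H w) ≤ ⨆ q, f q :=
      (ite_le_sup _ _ _).trans (sup_le (le_add_self.trans hf) zero_le)
    simpa [running] using hbound
  | returned H =>
    simp [condReturnProb, running, Set.indicator_apply]

lemma condReturnProb_loop_of_isSpanning (hTs : T.IsSpanning) (hT : IsSubtree T)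
    (hHs : H.IsSpanning) (hH : IsSubtree H) :
    condReturnProb T r (.loop H) = condReturnProb T r (.returned H) := by
  classical
  have hiff : H ≤ T ↔ H = T := ⟨eq_of_le_of_isSubtree hH hT hHs hTs, fun h => h.le⟩
  simp only [condReturnProb, hiff, SimpleGraph.Subgraph.isSpanning_iff.1 hHs,
    dirichletLaplacian_univ, Matrix.det_one, inv_one, ENNReal.ofReal_one]

lemma condReturnProb_walking_nil (hG : G.Connected) (hH : H.verts.Nonempty) (v : V) :
    condReturnProb T r (.walking H (.nil : G.Walk v v)) = condReturnProb T r (.loop H) := by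
  classical
  simp only [condReturnProb, loopErasure_eq_bypass, SimpleGraph.Walk.bypass,
    SimpleGraph.Walk.support_nil, potential_cons_self hG hH]
  simp [potential]

lemma condReturnProb_walking_of_mem (hG : G.Connected) (hTs : T.IsSpanning) (hT : IsSubtree T)
    (hH : IsSubtree H) (hr : r ∈ H.verts) (hx : x ∈ H.verts) {w : G.Walk x v}
    (hw : ∀ y ∈ w.support.tail, y ∉ H.verts) :
    condReturnProb T r (.walking H w) =
      condReturnProb T r (.loop (H ⊔ (loopErasure w).toSubgraph)) := by
  classical
  by_cases hle : H ≤ T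
  · have htail := notMem_of_mem_tail_support_loopErasure hw
    obtain ⟨q, hq, hqH⟩ := exists_isPath_spanningCoe (isSubtree_iff.1 hH).1 hle hx hr
    have hiff := toSubgraph_le_iff_isChain_isParent (isTree_spanningCoe hTs hT) hTs hq
      (loopErasure_isPath w) fun y hy hyq => htail y hy (hqH y hyq)
    simp only [condReturnProb, sup_le_iff, hle, true_and, if_true, hiff, verts_sup_toSubgraph hx]
    rw [← SimpleGraph.Walk.cons_tail_support (loopErasure w), List.tail_cons,
      potential_cons_self_of_mem hG htail hx, apply_ite ENNReal.ofReal, ENNReal.ofReal_zero]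
  · simp only [condReturnProb, sup_le_iff, hle, false_and, if_false]

open Classical in
lemma expect_condReturnProb_walking_cons (hG : G.Connected) (hTs : T.IsSpanning)
    (hT : IsSubtree T) (hr : r ∈ H.verts) (hx : x ∉ H.verts) {w : G.Walk x v}
    [Nonempty (G.neighborSet x)] :
    (expect (PMF.uniformOfFintype (G.neighborSet x)) fun y =>
      condReturnProb T r (.walking H (.cons y.2.symm w))) = condReturnProb T r (.walking H w) := by
  by_cases hle : H ≤ T
  · have hxr : x ≠ r := (ne_of_mem_of_not_mem hr hx).symm
    obtain ⟨p, hp, hpuniq⟩ := existsUnique_isParent (isTree_spanningCoe hTs hT) hxr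
    have hnodup := (loopErasure_isPath w).support_nodup
    rw [← SimpleGraph.Walk.cons_tail_support] at hnodup
    simp only [condReturnProb, hle, if_true, support_loopErasure_cons]
    refine expect_uniformOfFintype_neighborSet
      (fun y => potential_nonneg hG ⟨r, hr⟩ (loopErasedCons y _) y) ?_
    rw [← SimpleGraph.Walk.cons_tail_support (loopErasure w)]
    exact degree_mul_potential_eq_sum hG ⟨r, hr⟩ (fun l => nodup_of_isChain_isParent)
      hp.1.symm.adj_sub (fun y => ⟨hpuniq y, fun h => h ▸ hp⟩) hx hnodup.notMem
  · simp only [condReturnProb, hle, if_false, expect_const]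

lemma expect_step_condReturnProb (hG : G.Connected) (hTs : T.IsSpanning) (hT : IsSubtree T)
    {τ : G.Subgraph} (hr : r ∈ τ.verts) {s : State G} (hs : Invariant τ s) :
    expect (step G s) (condReturnProb T r) = condReturnProb T r s := by
  cases s with
  | returned H => rw [step, expect_pure]
  | loop H =>
    by_cases hHs : H.IsSpanning
    · rw [step_loop_of_isSpanning hHs, expect_pure,
        condReturnProb_loop_of_isSpanning hTs hT hHs hs.2]
    · have : Nonempty {v : V // v ∉ H.verts} := nonempty_subtype.2 (not_forall.1 hHs)
      simp only [step_loop_of_nonempty, expect_map, Function.comp_def,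
        condReturnProb_walking_nil hG (nonempty_verts_of_isSubtree hs.2), expect_const]
  | @walking H x v w =>
    obtain ⟨⟨hle, hH⟩, -, hw⟩ := hs
    by_cases hx : x ∈ H.verts
    · rw [step_walking_of_mem w hx, expect_pure,
        condReturnProb_walking_of_mem hG hTs hT hH (hle.1 hr) hx hw]
    · have := nonempty_neighborSet hG ⟨r, hle.1 hr⟩ hx
      rw [step_walking_of_notMem w hx, expect_map]
      exact expect_condReturnProb_walking_cons hG hTs hT (hle.1 hr) hx

end Uniformity

/-! ### Termination -/

section Termination

variable [Fintype V] {G : SimpleGraph V} {τ H : G.Subgraph} {x v : V}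

open Classical in
/-- The maximal expected hitting time, over all targets and all starting points. (The empty target
contributes a meaningless but finite value.) -/
noncomputable def maxHittingTime (G : SimpleGraph V) : ℝ≥0∞ :=
  ⨆ (B : Set V) (x : V), ENNReal.ofReal (hittingTime G B x)

lemma maxHittingTime_ne_top : maxHittingTime G ≠ ∞ :=
  iSup_ne_top fun _ => iSup_ne_top fun _ => ENNReal.ofReal_ne_top

open Classical in
/-- A bound for the expected number of steps that the algorithm still makes: every vertex outside
of the current tree costs at most the walk started from it and two further steps. -/
noncomputable def timeBound : State G → ℝ≥0∞
  | .loop H => (maxHittingTime G + 2) * H.vertsᶜ.ncard + 1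
  | .walking (x := x) (v := v) H _ =>
      ENNReal.ofReal (hittingTime G H.verts x) +
        ((maxHittingTime G + 2) * (H.vertsᶜ \ {v}).ncard + 2)
  | .returned _ => 0

lemma timeBound_loop_ne_top : timeBound (.loop H) ≠ ∞ := by
  simp [timeBound, maxHittingTime_ne_top, ENNReal.mul_eq_top]

lemma timeBound_walking_nil_add_one_le (hv : v ∉ H.verts) :
    timeBound (.walking H (.nil : G.Walk v v)) + 1 ≤ timeBound (.loop H) := by
  classical
  have hK : ENNReal.ofReal (hittingTime G H.verts v) ≤ maxHittingTime G :=
    le_iSup₂ (f := fun B x => ENNReal.ofReal (hittingTime G B x)) H.verts v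
  have hcard : (H.vertsᶜ.ncard : ℝ≥0∞) = (H.vertsᶜ \ {v}).ncard + 1 := by
    exact_mod_cast (Set.ncard_sdiff_singleton_add_one (Set.mem_compl hv) (Set.toFinite _)).symm
  rw [timeBound, timeBound, hcard]
  calc _ ≤ maxHittingTime G + ((maxHittingTime G + 2) * (H.vertsᶜ \ {v}).ncard + 2) + 1 := by
        gcongr
    _ = _ := by ring

lemma timeBound_loop_sup_add_one_le (w : G.Walk x v) :
    timeBound (.loop (H ⊔ (loopErasure w).toSubgraph)) + 1 ≤ timeBound (.walking H w) := by
  have hsub : (H ⊔ (loopErasure w).toSubgraph).vertsᶜ ⊆ H.vertsᶜ \ {v} := by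
    refine Set.subset_sdiff_singleton (Set.compl_subset_compl.2 fun y => Or.inl) ?_
    exact not_not.2 (Or.inr (loopErasure w).end_mem_verts_toSubgraph)
  rw [timeBound, timeBound, add_assoc, one_add_one_eq_two]
  refine le_add_left ?_
  gcongr
  exact Set.toFinite _

open Classical in
lemma expect_timeBound_walking_cons (hG : G.Connected) (hH : H.verts.Nonempty) (hx : x ∉ H.verts)
    {w : G.Walk x v} [Nonempty (G.neighborSet x)] :
    (expect (PMF.uniformOfFintype (G.neighborSet x)) fun y =>
      timeBound (.walking H (.cons y.2.symm w))) + 1 = timeBound (.walking H w) := by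
  have hnonneg (y : V) : 0 ≤ hittingTime G H.verts y := hittingTime_nonneg hG hH y
  have hsum : G.degree x * hittingTime G H.verts x =
      ∑ y ∈ G.neighborFinset x, (hittingTime G H.verts y + 1) := by
    rw [Finset.sum_add_distrib, Finset.sum_const, SimpleGraph.card_neighborFinset_eq_degree,
      nsmul_eq_mul, mul_one, add_comm]
    exact degree_mul_hittingTime hG hH hx
  have hmean := expect_uniformOfFintype_neighborSet (fun y => add_nonneg (hnonneg y) zero_le_one)
    hsum
  simp only [ENNReal.ofReal_add (hnonneg _) zero_le_one, ENNReal.ofReal_one] at hmean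
  simp only [expect_add_const] at hmean
  simp only [timeBound, expect_add_const, ← hmean, add_right_comm]

lemma expect_step_timeBound_add_indicator_le (hG : G.Connected) {s : State G}
    (hs : Invariant τ s) :
    expect (step G s) timeBound + (running G).indicator 1 s ≤ timeBound s := by
  cases s with
  | returned H => simp [step, expect_pure, running, timeBound]
  | loop H =>
    rw [Set.indicator_of_mem (by simp [running]), Pi.one_apply]
    by_cases hHs : H.IsSpanning
    · rw [step_loop_of_isSpanning hHs, expect_pure, timeBound, timeBound, zero_add]
      exact le_add_self
    · have : Nonempty {v : V // v ∉ H.verts} := nonempty_subtype.2 (not_forall.1 hHs)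
      rw [step_loop_of_nonempty, expect_map, ← expect_add_const]
      exact (expect_mono fun v _ => timeBound_walking_nil_add_one_le v.2).trans
        (expect_const _ _).le
  | @walking H x v w =>
    rw [Set.indicator_of_mem (by simp [running]), Pi.one_apply]
    have hH := hs.1.2
    by_cases hx : x ∈ H.verts
    · rw [step_walking_of_mem w hx, expect_pure]
      exact timeBound_loop_sup_add_one_le w
    · have hne := nonempty_verts_of_isSubtree hH
      have := nonempty_neighborSet hG hne hx
      rw [step_walking_of_notMem w hx, expect_map]
      exact (expect_timeBound_walking_cons hG hne hx).le

lemma tendsto_law_running (hG : G.Connected) (hτ : IsSubtree τ) :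
    Tendsto (fun n => (law G τ n).toOuterMeasure (running G)) atTop (𝓝 0) := by
  refine tendsto_toOuterMeasure_of_drift (fun _ => rfl) (support_law_subset hG hτ) ?_
    fun s hs => expect_step_timeBound_add_indicator_le hG hs
  rw [law, expect_pure]
  exact timeBound_loop_ne_top

end Termination

/-! ### The output -/

section Output

lemma eq_inv_ncard_of_tsum_eq_one [Finite α] {p : α → ℝ≥0∞} (hp : ∑' a, p a = 1) {S : Set α}
    {c : ℝ≥0∞} (hS : ∀ a ∈ S, p a = c) (hSc : ∀ a ∉ S, p a = 0) : c = (S.ncard : ℝ≥0∞)⁻¹ := by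
  have hind : p = S.indicator fun _ => c := by
    ext a
    by_cases ha : a ∈ S
    · rw [Set.indicator_of_mem ha, hS a ha]
    · rw [Set.indicator_of_notMem ha, hSc a ha]
  rw [hind, ← tsum_subtype, ENNReal.tsum_const, ENat.card_coe_set_eq, mul_comm,
    ← S.toFinite.cast_ncard_eq] at hp
  exact ENNReal.eq_inv_of_mul_eq_one_left hp

variable [Fintype V] {G : SimpleGraph V} {τ T : G.Subgraph}

lemma tsum_returnProb_eq_one (hG : G.Connected) (hτ : IsSubtree τ) :
    ∑' T : G.Subgraph, returnProb G τ T = 1 :=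
  tsum_iSup_apply_eq_one (fun _ _ => State.returned.inj)
    (fun _ => monotone_apply_of_absorbing (κ := step G) (fun _ => rfl) rfl)
    (tendsto_law_running hG hτ)

lemma returnProb_eq_ofReal_inv_det [DecidableEq V] [DecidableRel G.Adj] (hG : G.Connected)
    (hτ : IsSubtree τ) (hT : T ∈ spanningTreesContaining G τ) :
    returnProb G τ T = ENNReal.ofReal (dirichletLaplacian G τ.verts).det⁻¹ := by
  obtain ⟨hTs, hTree, hle⟩ := hT
  obtain ⟨r, hr⟩ := nonempty_verts_of_isSubtree hτ
  obtain ⟨K, hK, hbound⟩ := exists_condReturnProb_le T r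
  calc returnProb G τ T = expect (law G τ 0) (condReturnProb T r) :=
        iSup_apply_eq_expect_of_harmonic (fun _ => rfl) (support_law_subset hG hτ)
          (fun s hs => expect_step_condReturnProb hG hTs hTree hr hs)
          (tendsto_law_running hG hτ) condReturnProb_returned_self hK hbound
    _ = ENNReal.ofReal (dirichletLaplacian G τ.verts).det⁻¹ := by
        rw [law, expect_pure, condReturnProb, if_pos hle]
        congr!

lemma returnProb_eq_zero (hG : G.Connected) (hτ : IsSubtree τ)
    (hT : T ∉ spanningTreesContaining G τ) : returnProb G τ T = 0 := by
  refine ENNReal.iSup_eq_zero.2 fun n => (PMF.apply_eq_zero_iff _ _).2 fun hn => hT ?_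
  obtain ⟨⟨hle, hTree⟩, hTs⟩ := support_law_subset hG hτ n hn
  exact ⟨hTs, hTree, hle⟩

end Output

end Wilson

theorem mainTheorem2 {V : Type*} [Fintype V] (G : SimpleGraph V) (hG : G.Connected)
    (τ : G.Subgraph) (hτ : Wilson.IsSubtree τ) (hns : ¬ τ.IsSpanning) :
    -- the algorithm terminates with probability one
    (∑' T : G.Subgraph, Wilson.returnProb G τ T = 1) ∧
    -- its output is uniformly distributed on the spanning trees that contain `τ`
    (∀ T ∈ Wilson.spanningTreesContaining G τ,
      Wilson.returnProb G τ T = ((Wilson.spanningTreesContaining G τ).ncard : ENNReal)⁻¹) ∧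
    (∀ T ∉ Wilson.spanningTreesContaining G τ, Wilson.returnProb G τ T = 0) := by
  classical
  have hsum := Wilson.tsum_returnProb_eq_one hG hτ
  have hin (T) := Wilson.returnProb_eq_ofReal_inv_det (T := T) hG hτ
  have hout (T) := Wilson.returnProb_eq_zero (T := T) hG hτ
  refine ⟨hsum, fun T hT => ?_, hout⟩
  rw [hin T hT]
  exact Wilson.eq_inv_ncard_of_tsum_eq_one hsum hin hout
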